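/- **Strong completeness of propositional dependence logic $\mathbf{PD}$.** *Formulas.* Let $p_i$ ($i\in\mathbb N$) be the propositional variables. The formulas of $\mathbf{PD}$ are given by $$\phi ::= p_i \mid \neg p_i \mid \bot \mid {=}(p_{i_1},\dots,p_{i_k},p_j) \mid (\phi\wedge\phi) \mid (\phi\otimes\phi),$$ where $k\ge 0$ (for $k=0$ the dependence atom is written ${=}(p_j)$). A formula is *classical* if no dependence atom occurs in it. *Semantics.* A valuation is a function $s:\mathbb N\to\{0,1\}$ and a team is a set $X$ of valuations. Define $X\models p_i$ iff $s(i)=1$ for all $s\in X$; $X\models\neg p_i$ iff $s(i)=0$ for all $s\in X$; $X\models\bot$ iff $X=\emptyset$; $X\models{=}(p_{i_1},\dots,p_{i_k},p_j)$ iff for all $s,s'\in X$, if $s(i_1)=s'(i_1),\dots,s(i_k)=s'(i_k)$ then $s(j)=s'(j)$; $X\models\phi\wedge\psi$ iff $X\models\phi$ and $X\models\psi$; $X\models\phi\otimes\psi$ iff $X=Y\cup Z$ for some $Y,Z\subseteq X$ with $Y\models\phi$ and $Z\models\psi$. For a set $\Gamma$ of formulas, $\Gamma\models\phi$ means that every team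 satisfying all members of $\Gamma$ satisfies $\phi$. *Deduction.* $\Gamma\vdash\phi$ means that $\phi\in\Gamma$ or there is a (finite) natural deduction derivation of $\phi$ with undischarged hypotheses in $\Gamma$, using the following axioms and rules. Here $\phi,\psi,\chi,\theta$ are arbitrary formulas, $\alpha$ is a classical formula, $p_i,p_j,\dots$ are arbitrary propositional variables, $[\cdot]$ marks hypotheses that the rule discharges, and the subderivations may use further hypotheses. - Axioms: $p_i\otimes\neg p_i$. - Conjunction: from $\phi$ and $\psi$ infer $\phi\wedge\psi$; from $\phi\wedge\psi$ infer $\phi$, and infer $\psi$. - Tensor introduction: from $\phi$ infer $\phi\otimes\psi$; from $\psi$ infer $\phi\otimes\psi$. - Weak tensor elimination: from $\phi\otimes\psi$, a derivation of $\alpha$ from $[\phi]$ and a derivation of $\alpha$ from $[\psi]$, infer $\alpha$ ($\alpha$ classical). - Tensor substitution: from $\phi\otimes\psi$ and a derivation of $\chi$ from $[\psi]$, infer $\phi\otimes\chi$. - Commutativity and associativity: from $\phi\otimes\psi$ infer $\psi\otimes\phi$; from $\phi\otimes(\psi\otimes\chi)$ infer $(\phi\otimes\psi)\otimes\chi$.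 - Contradiction: from $p_i\wedge\neg p_i$ infer $\bot$; from $\phi\otimes\bot$ infer $\phi$. - Dependence atom introduction: from $p_i$ infer ${=}(p_i)$; from $\neg p_i$ infer ${=}(p_i)$; from a derivation of ${=}(p_j)$ from $[{=}(p_{i_1})],\dots,[{=}(p_{i_k})]$ infer ${=}(p_{i_1},\dots,p_{i_k},p_j)$. - Dependence atom elimination: from ${=}(p_i)$, a derivation of $\theta$ from $[p_i]$ and a derivation of $\theta$ from $[\neg p_i]$, infer $\theta$; from ${=}(p_{i_1},\dots,p_{i_k},p_j)$ and ${=}(p_{i_1}),\dots,{=}(p_{i_k})$ infer ${=}(p_j)$. - Strong elimination: let $\phi$ be a formula with a specified single occurrence of an atom ${=}(p_i)$, and let $\phi_1$, $\phi_0$ be obtained from $\phi$ by replacing that one occurrence by $p_i$, respectively by $\neg p_i$. From $\phi$, a derivation of $\theta$ from $[\phi_1]$ and a derivation of $\theta$ from $[\phi_0]$, infer $\theta$. **Theorem.** For any (possibly infinite) set $\Gamma\cup\{\phi\}$ of $\mathbf{PD}$ formulas, $$\Gamma\models\phi\ \Longrightarrow\ \Gamma\vdash\phi.$$ -/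

import Mathlib

namespace PDLogic

/-- Formulas of propositional dependence logic. The propositional variables are `p i`, `i : ℕ`;
`negVar i` is the negated variable, and `dep [i₁, …, iₖ] j` is the dependence atom
`=(p_{i₁}, …, p_{iₖ}, p_j)`. For `k = 0` this is the constancy atom `=(p_j)`. -/
inductive Formula : Type
  | var (i : ℕ) : Formula
  | negVar (i : ℕ) : Formula
  | bot : Formula
  | dep (is : List ℕ) (j : ℕ) : Formula
  | and (φ ψ : Formula) : Formula
  | tensor (φ ψ : Formula) : Formula

/-- The constancy dependence atom `=(p_i)`. -/
abbrev Formula.const (i : ℕ) : Formula := .dep [] i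

/-- A formula is classical if no dependence atom occurs in it. -/
def Formula.IsClassical : Formula → Prop
  | .var _ => True
  | .negVar _ => True
  | .bot => True
  | .dep _ _ => False
  | .and φ ψ => φ.IsClassical ∧ ψ.IsClassical
  | .tensor φ ψ => φ.IsClassical ∧ ψ.IsClassical

/-- A valuation assigns a truth value to each propositional variable. -/
abbrev Valuation : Type := ℕ → Bool

/-- A team is an arbitrary set of valuations. -/
abbrev Team : Type := Set Valuation

/-- Truth of a formula on a team. -/
def Sat (X : Team) : Formula → Prop
  | .var i => ∀ s ∈ X, s i = true
  | .negVar i => ∀ s ∈ X, s i = false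
  | .bot => X = ∅
  | .dep is j => ∀ s ∈ X, ∀ s' ∈ X, (∀ i ∈ is, s i = s' i) → s j = s' j
  | .and φ ψ => Sat X φ ∧ Sat X ψ
  | .tensor φ ψ => ∃ Y Z : Team, X = Y ∪ Z ∧ Sat Y φ ∧ Sat Z ψ

/-- Semantic consequence: every team that satisfies all of `Γ` satisfies `φ`. -/
def Entails (Γ : Set Formula) (φ : Formula) : Prop :=
  ∀ X : Team, (∀ γ ∈ Γ, Sat X γ) → Sat X φ

/-- Formulas with exactly one hole. A way of writing `φ` as `C.fill α` is the same thing as an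
occurrence of the subformula `α` in `φ`, and `C.fill β` is then the result of replacing
that one occurrence by `β`. -/
inductive OneHole : Type
  | hole : OneHole
  | andLeft (C : OneHole) (ψ : Formula) : OneHole
  | andRight (φ : Formula) (C : OneHole) : OneHole
  | tensorLeft (C : OneHole) (ψ : Formula) : OneHole
  | tensorRight (φ : Formula) (C : OneHole) : OneHole

/-- Put a formula in the hole. -/
def OneHole.fill : OneHole → Formula → Formula
  | .hole, α => α
  | .andLeft C ψ, α => .and (C.fill α) ψ
  | .andRight φ C, α => .and φ (C.fill α)
  | .tensorLeft C ψ, α => .tensor (C.fill α) ψ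
  | .tensorRight φ C, α => .tensor φ (C.fill α)

/-- The natural deduction system: `Derives Γ φ` says that there is a derivation of `φ` all of whose
undischarged hypotheses lie in `Γ`. A hypothesis discharged by a rule is added to
the set of hypotheses in the corresponding premise. -/
inductive Derives : Set Formula → Formula → Prop
  /-- Hypotheses. -/
  | hyp {Γ : Set Formula} {φ : Formula} : φ ∈ Γ → Derives Γ φ
  /-- Atomic excluded middle. -/
  | em (Γ : Set Formula) (i : ℕ) : Derives Γ (.tensor (.var i) (.negVar i))
  /-- Conjunction introduction. -/
  | andI {Γ : Set Formula} {φ ψ : Formula} :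
      Derives Γ φ → Derives Γ ψ → Derives Γ (.and φ ψ)
  /-- Conjunction elimination. -/
  | andEleft {Γ : Set Formula} {φ ψ : Formula} : Derives Γ (.and φ ψ) → Derives Γ φ
  | andEright {Γ : Set Formula} {φ ψ : Formula} : Derives Γ (.and φ ψ) → Derives Γ ψ
  /-- Tensor introduction. -/
  | tensorIleft {Γ : Set Formula} {φ ψ : Formula} : Derives Γ φ → Derives Γ (.tensor φ ψ)
  | tensorIright {Γ : Set Formula} {φ ψ : Formula} : Derives Γ ψ → Derives Γ (.tensor φ ψ)
  /-- Tensor weak elimination: only classical conclusions. -/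
  | tensorE {Γ : Set Formula} {φ ψ α : Formula} : α.IsClassical → Derives Γ (.tensor φ ψ) →
      Derives (insert φ Γ) α → Derives (insert ψ Γ) α → Derives Γ α
  /-- Tensor substitution. -/
  | tensorSub {Γ : Set Formula} {φ ψ χ : Formula} : Derives Γ (.tensor φ ψ) →
      Derives (insert ψ Γ) χ → Derives Γ (.tensor φ χ)
  /-- Commutativity of the tensor. -/
  | tensorComm {Γ : Set Formula} {φ ψ : Formula} :
      Derives Γ (.tensor φ ψ) → Derives Γ (.tensor ψ φ)
  /-- Associativity of the tensor. -/
  | tensorAssoc {Γ : Set Formula} {φ ψ χ : Formula} :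
      Derives Γ (.tensor φ (.tensor ψ χ)) → Derives Γ (.tensor (.tensor φ ψ) χ)
  /-- Contradiction introduction. -/
  | botI {Γ : Set Formula} {i : ℕ} : Derives Γ (.and (.var i) (.negVar i)) → Derives Γ .bot
  /-- Contradiction elimination. -/
  | botE {Γ : Set Formula} {φ : Formula} : Derives Γ (.tensor φ .bot) → Derives Γ φ
  /-- Constancy atom introduction. -/
  | constIvar {Γ : Set Formula} {i : ℕ} : Derives Γ (.var i) → Derives Γ (.const i)
  | constInegVar {Γ : Set Formula} {i : ℕ} : Derives Γ (.negVar i) → Derives Γ (.const i)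
  /-- Dependence atom introduction: discharges `=(p_{i₁}), …, =(p_{iₖ})`. -/
  | depI {Γ : Set Formula} {is : List ℕ} {j : ℕ} :
      Derives (Γ ∪ {γ | ∃ i ∈ is, γ = .const i}) (.const j) → Derives Γ (.dep is j)
  /-- Constancy atom elimination. -/
  | constE {Γ : Set Formula} {i : ℕ} {θ : Formula} : Derives Γ (.const i) →
      Derives (insert (.var i) Γ) θ → Derives (insert (.negVar i) Γ) θ → Derives Γ θ
  /-- Dependence atom elimination. -/
  | depE {Γ : Set Formula} {is : List ℕ} {j : ℕ} : Derives Γ (.dep is j) →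
      (∀ i ∈ is, Derives Γ (.const i)) → Derives Γ (.const j)
  /-- Strong elimination, for one occurrence of a constancy atom `=(p_i)` in a formula. -/
  | strongE {Γ : Set Formula} (C : OneHole) {i : ℕ} {θ : Formula} :
      Derives Γ (C.fill (.const i)) → Derives (insert (C.fill (.var i)) Γ) θ →
      Derives (insert (C.fill (.negVar i)) Γ) θ → Derives Γ θ

end PDLogic

namespace PDLogic

/-! ### Structural properties of derivations. -/

namespace Derives

/-! Every formula behaves like a disjunction of classical formulas, its realizations. Semantically,
a team satisfies `φ` exactly when it satisfies some realization of `φ` (`Realization.sat`,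
`Realization.exists_sat`). The calculus matches this: each realization derives `φ`
(`Realization.derives`), and whatever follows from every realization follows from `φ`
(`Realization.elim`, by strong elimination).

If `Γ` does not derive `φ`, extend it to a maximal `Δ` not deriving `φ`. By maximality and
`Realization.elim`, `Δ` contains a realization of each member of `Γ`. Let `X` be the team of all
valuations verifying the classical members of `Δ`. Classical formulas are flat, so `X` satisfies
`Γ`, hence `φ`, hence a realization `α` of `φ`. Classical completeness (`derives_of_forall_holds`)
then gives a derivation of `α` from `Δ`, and so one of `φ`, a contradiction. -/

theorem mono {Γ Δ : Set Formula} {φ : Formula} (h : Derives Γ φ) (hs : Γ ⊆ Δ) : Derives Δ φ := by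
  induction h generalizing Δ with
  | hyp h => exact .hyp (hs h)
  | em _ i => exact .em _ i
  | andI _ _ ih₁ ih₂ => exact .andI (ih₁ hs) (ih₂ hs)
  | andEleft _ ih => exact .andEleft (ih hs)
  | andEright _ ih => exact .andEright (ih hs)
  | tensorIleft _ ih => exact .tensorIleft (ih hs)
  | tensorIright _ ih => exact .tensorIright (ih hs)
  | tensorE hc _ _ _ ih ih₁ ih₂ =>
    exact .tensorE hc (ih hs) (ih₁ (Set.insert_subset_insert hs)) (ih₂ (Set.insert_subset_insert hs))
  | tensorSub _ _ ih ih₁ => exact .tensorSub (ih hs) (ih₁ (Set.insert_subset_insert hs))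
  | tensorComm _ ih => exact .tensorComm (ih hs)
  | tensorAssoc _ ih => exact .tensorAssoc (ih hs)
  | botI _ ih => exact .botI (ih hs)
  | botE _ ih => exact .botE (ih hs)
  | constIvar _ ih => exact .constIvar (ih hs)
  | constInegVar _ ih => exact .constInegVar (ih hs)
  | depI _ ih => exact .depI (ih (Set.union_subset_union_left _ hs))
  | constE _ _ _ ih ih₁ ih₂ =>
    exact .constE (ih hs) (ih₁ (Set.insert_subset_insert hs)) (ih₂ (Set.insert_subset_insert hs))
  | depE _ _ ih ih₁ => exact .depE (ih hs) fun i hi => ih₁ i hi hs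
  | strongE C _ _ _ ih ih₁ ih₂ =>
    exact .strongE C (ih hs) (ih₁ (Set.insert_subset_insert hs))
      (ih₂ (Set.insert_subset_insert hs))

theorem weaken {Γ : Set Formula} {φ : Formula} (ψ : Formula) (h : Derives Γ φ) :
    Derives (insert ψ Γ) φ :=
  h.mono (Set.subset_insert _ _)

theorem head (Γ : Set Formula) (φ : Formula) : Derives (insert φ Γ) φ :=
  .hyp (Set.mem_insert _ _)

theorem subst_insert {Γ Δ : Set Formula} (h : ∀ γ ∈ Γ, Derives Δ γ) (ψ : Formula) :
    ∀ γ ∈ insert ψ Γ, Derives (insert ψ Δ) γ := by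
  rintro γ (rfl | hγ)
  · exact head _ _
  · exact (h γ hγ).weaken _

/-- Hypotheses may be replaced by derivations of them. -/
theorem subst {Γ Δ : Set Formula} {φ : Formula} (h : Derives Γ φ)
    (hs : ∀ γ ∈ Γ, Derives Δ γ) : Derives Δ φ := by
  induction h generalizing Δ with
  | hyp h => exact hs _ h
  | em _ i => exact .em _ i
  | andI _ _ ih₁ ih₂ => exact .andI (ih₁ hs) (ih₂ hs)
  | andEleft _ ih => exact .andEleft (ih hs)
  | andEright _ ih => exact .andEright (ih hs)
  | tensorIleft _ ih => exact .tensorIleft (ih hs)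
  | tensorIright _ ih => exact .tensorIright (ih hs)
  | tensorE hc _ _ _ ih ih₁ ih₂ =>
    exact .tensorE hc (ih hs) (ih₁ (subst_insert hs _)) (ih₂ (subst_insert hs _))
  | tensorSub _ _ ih ih₁ => exact .tensorSub (ih hs) (ih₁ (subst_insert hs _))
  | tensorComm _ ih => exact .tensorComm (ih hs)
  | tensorAssoc _ ih => exact .tensorAssoc (ih hs)
  | botI _ ih => exact .botI (ih hs)
  | botE _ ih => exact .botE (ih hs)
  | constIvar _ ih => exact .constIvar (ih hs)
  | constInegVar _ ih => exact .constInegVar (ih hs)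
  | depI _ ih =>
    refine .depI (ih ?_)
    rintro γ (hγ | hγ)
    · exact (hs γ hγ).mono Set.subset_union_left
    · exact .hyp (Or.inr hγ)
  | constE _ _ _ ih ih₁ ih₂ =>
    exact .constE (ih hs) (ih₁ (subst_insert hs _)) (ih₂ (subst_insert hs _))
  | depE _ _ ih ih₁ => exact .depE (ih hs) fun i hi => ih₁ i hi hs
  | strongE C _ _ _ ih ih₁ ih₂ =>
    exact .strongE C (ih hs) (ih₁ (subst_insert hs _)) (ih₂ (subst_insert hs _))

theorem cut {Γ : Set Formula} {φ ψ : Formula} (h₁ : Derives Γ φ)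
    (h₂ : Derives (insert φ Γ) ψ) : Derives Γ ψ := by
  refine h₂.subst ?_
  rintro γ (rfl | hγ)
  · exact h₁
  · exact .hyp hγ

theorem exFalso {Γ : Set Formula} {φ : Formula} (h : Derives Γ .bot) : Derives Γ φ :=
  .botE (.tensorIright h)

/-- A finite set of hypotheses from `Δ ∪ E` lies in `F ∪ E` for a finite subset `F` of `Δ`. -/
theorem finite_left {Δ E F : Set Formula} {φ : Formula} (hF : F.Finite) (hs : F ⊆ Δ ∪ E)
    (h : Derives F φ) : ∃ F' ⊆ Δ, F'.Finite ∧ Derives (F' ∪ E) φ := by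
  refine ⟨F \ E, fun x hx => (hs hx.1).resolve_right hx.2, hF.sdiff, h.mono fun x hx => ?_⟩
  by_cases hE : x ∈ E
  · exact .inr hE
  · exact .inl ⟨hx, hE⟩

theorem finite_insert {Δ F : Set Formula} {φ ψ : Formula} (hF : F.Finite) (hs : F ⊆ insert ψ Δ)
    (h : Derives F φ) : ∃ F' ⊆ Δ, F'.Finite ∧ Derives (insert ψ F') φ := by
  obtain ⟨F', h₁, h₂, h₃⟩ := finite_left (Δ := Δ) (E := {ψ}) hF (by rwa [Set.union_singleton]) h
  exact ⟨F', h₁, h₂, by rwa [Set.union_singleton] at h₃⟩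

/-- A derivation uses only finitely many hypotheses. -/
theorem exists_finite {Γ : Set Formula} {φ : Formula} (h : Derives Γ φ) :
    ∃ F ⊆ Γ, F.Finite ∧ Derives F φ := by
  induction h with
  | @hyp Γ φ h =>
    exact ⟨{φ}, Set.singleton_subset_iff.2 h, Set.finite_singleton _, .hyp rfl⟩
  | em _ i => exact ⟨∅, Set.empty_subset _, Set.finite_empty, .em _ i⟩
  | andI _ _ ih₁ ih₂ =>
    obtain ⟨F, a, b, c⟩ := ih₁
    obtain ⟨G, a', b', c'⟩ := ih₂
    exact ⟨F ∪ G, Set.union_subset a a', b.union b',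
      .andI (c.mono Set.subset_union_left) (c'.mono Set.subset_union_right)⟩
  | andEleft _ ih => obtain ⟨F, a, b, c⟩ := ih; exact ⟨F, a, b, .andEleft c⟩
  | andEright _ ih => obtain ⟨F, a, b, c⟩ := ih; exact ⟨F, a, b, .andEright c⟩
  | tensorIleft _ ih => obtain ⟨F, a, b, c⟩ := ih; exact ⟨F, a, b, .tensorIleft c⟩
  | tensorIright _ ih => obtain ⟨F, a, b, c⟩ := ih; exact ⟨F, a, b, .tensorIright c⟩
  | tensorComm _ ih => obtain ⟨F, a, b, c⟩ := ih; exact ⟨F, a, b, .tensorComm c⟩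
  | tensorAssoc _ ih => obtain ⟨F, a, b, c⟩ := ih; exact ⟨F, a, b, .tensorAssoc c⟩
  | botI _ ih => obtain ⟨F, a, b, c⟩ := ih; exact ⟨F, a, b, .botI c⟩
  | botE _ ih => obtain ⟨F, a, b, c⟩ := ih; exact ⟨F, a, b, .botE c⟩
  | constIvar _ ih => obtain ⟨F, a, b, c⟩ := ih; exact ⟨F, a, b, .constIvar c⟩
  | constInegVar _ ih => obtain ⟨F, a, b, c⟩ := ih; exact ⟨F, a, b, .constInegVar c⟩
  | tensorE hc _ _ _ ih ih₁ ih₂ =>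
    obtain ⟨F, a, b, c⟩ := ih
    obtain ⟨_, a₁, b₁, c₁⟩ := ih₁
    obtain ⟨G, a₁, b₁, c₁⟩ := finite_insert b₁ a₁ c₁
    obtain ⟨_, a₂, b₂, c₂⟩ := ih₂
    obtain ⟨H, a₂, b₂, c₂⟩ := finite_insert b₂ a₂ c₂
    exact ⟨F ∪ (G ∪ H), by simp [*], b.union (b₁.union b₂), .tensorE hc (c.mono (by grind))
      (c₁.mono (by grind)) (c₂.mono (by grind))⟩
  | tensorSub _ _ ih ih₁ =>
    obtain ⟨F, a, b, c⟩ := ih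
    obtain ⟨_, a₁, b₁, c₁⟩ := ih₁
    obtain ⟨G, a₁, b₁, c₁⟩ := finite_insert b₁ a₁ c₁
    exact ⟨F ∪ G, by simp [*], b.union b₁, .tensorSub (c.mono (by grind)) (c₁.mono (by grind))⟩
  | depI _ ih =>
    obtain ⟨_, a, b, c⟩ := ih
    obtain ⟨F, a, b, c⟩ := finite_left b a c
    exact ⟨F, a, b, .depI c⟩
  | constE _ _ _ ih ih₁ ih₂ =>
    obtain ⟨F, a, b, c⟩ := ih
    obtain ⟨_, a₁, b₁, c₁⟩ := ih₁
    obtain ⟨G, a₁, b₁, c₁⟩ := finite_insert b₁ a₁ c₁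
    obtain ⟨_, a₂, b₂, c₂⟩ := ih₂
    obtain ⟨H, a₂, b₂, c₂⟩ := finite_insert b₂ a₂ c₂
    exact ⟨F ∪ (G ∪ H), by simp [*], b.union (b₁.union b₂), .constE (c.mono (by grind))
      (c₁.mono (by grind)) (c₂.mono (by grind))⟩
  | @depE Γ is j _ _ ih ih₁ =>
    obtain ⟨F, a, b, c⟩ := ih
    choose! G hG using ih₁
    refine ⟨F ∪ ⋃ i ∈ {i | i ∈ is}, G i, ?_, ?_, .depE (c.mono Set.subset_union_left) fun i hi => ?_⟩
    · exact Set.union_subset a (Set.iUnion₂_subset fun i hi => (hG i hi).1)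
    · exact b.union ((List.finite_toSet is).biUnion fun i hi => (hG i hi).2.1)
    · exact (hG i hi).2.2.mono
        ((Set.subset_biUnion_of_mem (u := G) (s := {i | i ∈ is}) hi).trans Set.subset_union_right)
  | strongE C _ _ _ ih ih₁ ih₂ =>
    obtain ⟨F, a, b, c⟩ := ih
    obtain ⟨_, a₁, b₁, c₁⟩ := ih₁
    obtain ⟨G, a₁, b₁, c₁⟩ := finite_insert b₁ a₁ c₁
    obtain ⟨_, a₂, b₂, c₂⟩ := ih₂
    obtain ⟨H, a₂, b₂, c₂⟩ := finite_insert b₂ a₂ c₂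
    exact ⟨F ∪ (G ∪ H), by simp [*], b.union (b₁.union b₂), .strongE C (c.mono (by grind))
      (c₁.mono (by grind)) (c₂.mono (by grind))⟩

/-- Lindenbaum's lemma: a set that does not derive `φ` extends to a maximal such set. -/
theorem exists_maximal {Γ : Set Formula} {φ : Formula} (h : ¬ Derives Γ φ) :
    ∃ Δ, Γ ⊆ Δ ∧ ¬ Derives Δ φ ∧ ∀ ψ, ψ ∉ Δ → Derives (insert ψ Δ) φ := by
  obtain ⟨Δ, hΓ, hΔ⟩ := zorn_subset_nonempty {Δ : Set Formula | ¬ Derives Δ φ} (fun c hc hch hne => by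
    refine ⟨⋃₀ c, fun hd => ?_, fun s hs => Set.subset_sUnion_of_mem hs⟩
    -- The finitely many hypotheses used already lie in one member of the chain.
    obtain ⟨F, hF, hfin, hd⟩ := hd.exists_finite
    obtain ⟨t, ht, hFt⟩ := hch.directedOn.exists_mem_subset_of_finite_of_subset_sUnion hne hfin hF
    exact hc ht (hd.mono hFt)) Γ h
  refine ⟨Δ, hΓ, hΔ.prop, fun ψ hψ => ?_⟩
  by_contra hd
  exact hψ (hΔ.le_of_ge hd (Set.subset_insert _ _) (Set.mem_insert _ _))

/-- Replacement of a formula inside a context by a consequence of it. -/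
theorem replace {Γ : Set Formula} {φ ψ : Formula} (C : OneHole)
    (hr : Derives (insert φ Γ) ψ) (h : Derives Γ (C.fill φ)) : Derives Γ (C.fill ψ) := by
  induction C generalizing Γ with
  | hole => exact cut h hr
  | andLeft C χ ih => exact .andI (ih hr h.andEleft) h.andEright
  | andRight χ C ih => exact .andI h.andEleft (ih hr h.andEright)
  | tensorLeft C χ ih =>
    exact .tensorComm (.tensorSub h.tensorComm
      (ih (hr.mono (Set.insert_subset_insert (Set.subset_insert _ _))) (head _ _)))
  | tensorRight χ C ih =>
    exact .tensorSub h
      (ih (hr.mono (Set.insert_subset_insert (Set.subset_insert _ _))) (head _ _))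

/-! ### Derived rules for dependence atoms. -/

/-- A dependence atom splits according to the value of its first variable. -/
theorem dep_cons_split (Γ : Set Formula) (i : ℕ) (is : List ℕ) (j : ℕ) :
    Derives (insert (.dep (i :: is) j) Γ)
      (.tensor (.and (.var i) (.dep is j)) (.and (.negVar i) (.dep is j))) := by
  have key : ∀ Δ : Set Formula, Formula.dep (i :: is) j ∈ Δ → Derives Δ (.const i) →
      Derives Δ (.dep is j) := by
    intro Δ hd hc
    refine .depI (.depE (.hyp (Or.inl hd)) fun k hk => ?_)
    rcases List.mem_cons.1 hk with rfl | hk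
    · exact hc.mono Set.subset_union_left
    · exact .hyp (Or.inr ⟨k, hk, rfl⟩)
  -- Either disjunct of excluded middle yields `=(p_i)`, which by `key` removes `i` from the atom.
  refine .tensorComm (.tensorSub (.tensorComm (.tensorSub (.em _ i) ?_)) ?_)
  · exact .andI (head _ _) (key _ (by simp) (.constInegVar (head _ _)))
  · exact .andI (head _ _) (key _ (by simp) (.constIvar (head _ _)))

/-- Composition of a dependence atom from its two halves. -/
theorem dep_cons_join {Γ : Set Formula} {i : ℕ} {is : List ℕ} {j : ℕ}
    (h : Derives Γ (.tensor (.and (.var i) (.dep is j)) (.and (.negVar i) (.dep is j)))) :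
    Derives Γ (.dep (i :: is) j) := by
  -- The discharged `=(p_i)` permits a case split on `p_i`. In each case the tensor disjunct with
  -- the opposite literal collapses to `⊥` and is erased by `botE`.
  refine .depI (.constE (i := i) (.hyp (Or.inr ⟨i, by simp, rfl⟩)) ?_ ?_)
  · refine .depE (is := is) (.andEright (φ := .var i) (.botE (.tensorSub
      ((h.mono Set.subset_union_left).weaken _) (.botI (i := i)
        (.andI ((head _ _).weaken _) (.andEleft (head _ _))))))) fun k hk => ?_
    exact .hyp (Or.inr (Or.inr ⟨k, by simp [hk], rfl⟩))
  · refine .depE (is := is) (.andEright (φ := .negVar i) (.botE (.tensorSub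
      ((h.mono Set.subset_union_left).weaken _).tensorComm (.botI (i := i)
        (.andI (.andEleft (head _ _)) ((head _ _).weaken _)))))) fun k hk => ?_
    exact .hyp (Or.inr (Or.inr ⟨k, by simp [hk], rfl⟩))

end Derives

/-! ### Classical realizations in the calculus. -/

/-- `Realization φ α` says that the classical formula `α` arises from `φ` by choosing, for every
occurrence of a dependence atom, a function that witnesses the dependence. -/
inductive Realization : Formula → Formula → Prop
  | var (i : ℕ) : Realization (.var i) (.var i)
  | negVar (i : ℕ) : Realization (.negVar i) (.negVar i)
  | bot : Realization .bot .bot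
  | constVar (j : ℕ) : Realization (.dep [] j) (.var j)
  | constNegVar (j : ℕ) : Realization (.dep [] j) (.negVar j)
  | depCons {i : ℕ} {is : List ℕ} {j : ℕ} {α β : Formula} : Realization (.dep is j) α →
      Realization (.dep is j) β →
      Realization (.dep (i :: is) j) (.tensor (.and (.var i) α) (.and (.negVar i) β))
  | and {φ ψ α β : Formula} : Realization φ α → Realization ψ β →
      Realization (.and φ ψ) (.and α β)
  | tensor {φ ψ α β : Formula} : Realization φ α → Realization ψ β →
      Realization (.tensor φ ψ) (.tensor α β)

/-- Composition of contexts. -/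
def OneHole.comp : OneHole → OneHole → OneHole
  | .hole, D => D
  | .andLeft C ψ, D => .andLeft (C.comp D) ψ
  | .andRight φ C, D => .andRight φ (C.comp D)
  | .tensorLeft C ψ, D => .tensorLeft (C.comp D) ψ
  | .tensorRight φ C, D => .tensorRight φ (C.comp D)

theorem OneHole.fill_comp (C D : OneHole) (φ : Formula) :
    (C.comp D).fill φ = C.fill (D.fill φ) := by
  induction C <;> simp_all [OneHole.comp, OneHole.fill]

theorem Derives.tensor_map {Γ : Set Formula} {φ φ' ψ ψ' : Formula}
    (h : Derives Γ (.tensor φ ψ)) (h₁ : Derives (insert φ Γ) φ')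
    (h₂ : Derives (insert ψ Γ) ψ') : Derives Γ (.tensor φ' ψ') :=
  .tensorComm (.tensorSub (.tensorComm (.tensorSub h h₂)) h₁)

namespace Realization

theorem isClassical {φ α : Formula} (h : Realization φ α) : α.IsClassical := by
  induction h <;> simp_all [Formula.IsClassical]

theorem derives {φ α : Formula} (h : Realization φ α) {Γ : Set Formula} (hd : Derives Γ α) :
    Derives Γ φ := by
  induction h generalizing Γ with
  | var | negVar | bot => exact hd
  | constVar j => exact .constIvar hd
  | constNegVar j => exact .constInegVar hd
  | depCons _ _ ih₁ ih₂ =>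
    exact .dep_cons_join (hd.tensor_map
      (.andI (.andEleft (.head _ _)) (ih₁ (.andEright (.head _ _))))
      (.andI (.andEleft (.head _ _)) (ih₂ (.andEright (.head _ _)))))
  | and _ _ ih₁ ih₂ => exact .andI (ih₁ hd.andEleft) (ih₂ hd.andEright)
  | tensor _ _ ih₁ ih₂ => exact hd.tensor_map (ih₁ (.head _ _)) (ih₂ (.head _ _))

/-- Splitting on the first variable replaces the atom, in place, by two copies of a shorter one. The
induction hypothesis is applied to each copy in turn, in a deeper context, so `C` must vary in the
induction. -/
theorem elim_dep {is : List ℕ} {j : ℕ} {Γ : Set Formula} {θ : Formula} (C : OneHole)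
    (h : Derives Γ (C.fill (.dep is j)))
    (hr : ∀ α, Realization (.dep is j) α → Derives (insert (C.fill α) Γ) θ) : Derives Γ θ := by
  induction is generalizing C Γ with
  | nil => exact .strongE C h (hr _ (.constVar j)) (hr _ (.constNegVar j))
  | cons i is ih =>
    have h' := Derives.replace C (Derives.dep_cons_split Γ i is j) h
    refine ih (C.comp (.tensorLeft (.andRight (.var i) .hole) (.and (.negVar i) (.dep is j))))
      (by simpa [OneHole.fill_comp, OneHole.fill] using h') fun α hα => ?_
    refine ih (C.comp (.tensorRight (.and (.var i) α) (.andRight (.negVar i) .hole)))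
      (by simpa [OneHole.fill_comp, OneHole.fill] using Derives.head _ _) fun β hβ => ?_
    simp only [OneHole.fill_comp, OneHole.fill]
    exact (hr _ (.depCons hα hβ)).mono (Set.insert_subset_insert (Set.subset_insert _ _))

/-- What follows from every realization of `φ` in a context follows from `φ` in that context. -/
theorem elim {φ : Formula} {Γ : Set Formula} {θ : Formula} (C : OneHole)
    (h : Derives Γ (C.fill φ))
    (hr : ∀ α, Realization φ α → Derives (insert (C.fill α) Γ) θ) : Derives Γ θ := by
  induction φ generalizing C Γ with
  | var i => exact h.cut (hr _ (.var i))
  | negVar i => exact h.cut (hr _ (.negVar i))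
  | bot => exact h.cut (hr _ .bot)
  | dep is j => exact elim_dep C h hr
  | and φ ψ ih₁ ih₂ =>
    -- A context has only one hole, so the components are realized one after the other: the second
    -- with the first already replaced by `α`.
    refine ih₁ (C.comp (.andLeft .hole ψ))
      (by simpa [OneHole.fill_comp, OneHole.fill] using h) fun α hα => ?_
    refine ih₂ (C.comp (.andRight α .hole))
      (by simpa [OneHole.fill_comp, OneHole.fill] using Derives.head _ _) fun β hβ => ?_
    simp only [OneHole.fill_comp, OneHole.fill]
    exact (hr _ (.and hα hβ)).mono (Set.insert_subset_insert (Set.subset_insert _ _))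
  | tensor φ ψ ih₁ ih₂ =>
    refine ih₁ (C.comp (.tensorLeft .hole ψ))
      (by simpa [OneHole.fill_comp, OneHole.fill] using h) fun α hα => ?_
    refine ih₂ (C.comp (.tensorRight α .hole))
      (by simpa [OneHole.fill_comp, OneHole.fill] using Derives.head _ _) fun β hβ => ?_
    simp only [OneHole.fill_comp, OneHole.fill]
    exact (hr _ (.tensor hα hβ)).mono (Set.insert_subset_insert (Set.subset_insert _ _))

/-! ### Realizations and team semantics. -/

theorem sat {φ α : Formula} (h : Realization φ α) {X : Team} (hX : Sat X α) : Sat X φ := by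
  induction h generalizing X with
  | var | negVar | bot => exact hX
  | constVar j => intro s hs s' hs' _; rw [hX s hs, hX s' hs']
  | constNegVar j => intro s hs s' hs' _; rw [hX s hs, hX s' hs']
  | depCons _ _ ih₁ ih₂ =>
    obtain ⟨Y, Z, rfl, ⟨hY, hY'⟩, hZ, hZ'⟩ := hX
    intro s hs s' hs' heq
    rw [List.forall_mem_cons] at heq
    -- Valuations agreeing at the first variable lie in the same half; the mixed cases contradict
    -- this agreement.
    rcases hs with hs | hs <;> rcases hs' with hs' | hs'
    · exact ih₁ hY' s hs s' hs' heq.2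
    · simp [hY s hs, hZ s' hs'] at heq
    · simp [hZ s hs, hY s' hs'] at heq
    · exact ih₂ hZ' s hs s' hs' heq.2
  | and _ _ ih₁ ih₂ => exact ⟨ih₁ hX.1, ih₂ hX.2⟩
  | tensor _ _ ih₁ ih₂ =>
    obtain ⟨Y, Z, rfl, hY, hZ⟩ := hX
    exact ⟨Y, Z, rfl, ih₁ hY, ih₂ hZ⟩

theorem exists_sat_dep {is : List ℕ} {j : ℕ} {X : Team} (h : Sat X (.dep is j)) :
    ∃ α, Realization (.dep is j) α ∧ Sat X α := by
  induction is generalizing X with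
  | nil =>
    by_cases hX : ∀ s ∈ X, s j = true
    · exact ⟨_, .constVar j, hX⟩
    · push Not at hX
      obtain ⟨s, hs, hsj⟩ := hX
      refine ⟨_, .constNegVar j, fun s' hs' => ?_⟩
      rw [h s' hs' s hs (by simp)]
      simpa using hsj
  | cons i is ih =>
    -- Once the team is cut by the value at `i`, agreement at `i` is automatic on each half, so the
    -- shorter atom holds there.
    obtain ⟨α, hα, hY⟩ := ih (X := {s ∈ X | s i = true}) fun s hs s' hs' heq =>
      h s hs.1 s' hs'.1 (List.forall_mem_cons.2 ⟨by rw [hs.2, hs'.2], heq⟩)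
    obtain ⟨β, hβ, hZ⟩ := ih (X := {s ∈ X | s i = false}) fun s hs s' hs' heq =>
      h s hs.1 s' hs'.1 (List.forall_mem_cons.2 ⟨by rw [hs.2, hs'.2], heq⟩)
    refine ⟨_, .depCons hα hβ, _, _, ?_, ⟨fun s hs => hs.2, hY⟩, fun s hs => hs.2, hZ⟩
    ext s
    cases hs : s i <;> simp [hs]

theorem exists_sat {φ : Formula} {X : Team} (h : Sat X φ) :
    ∃ α, Realization φ α ∧ Sat X α := by
  induction φ generalizing X with
  | var i => exact ⟨_, .var i, h⟩
  | negVar i => exact ⟨_, .negVar i, h⟩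
  | bot => exact ⟨_, .bot, h⟩
  | dep is j => exact exists_sat_dep h
  | and φ ψ ih₁ ih₂ =>
    obtain ⟨α, hα, h₁⟩ := ih₁ h.1
    obtain ⟨β, hβ, h₂⟩ := ih₂ h.2
    exact ⟨_, .and hα hβ, h₁, h₂⟩
  | tensor φ ψ ih₁ ih₂ =>
    obtain ⟨Y, Z, rfl, hY, hZ⟩ := h
    obtain ⟨α, hα, h₁⟩ := ih₁ hY
    obtain ⟨β, hβ, h₂⟩ := ih₂ hZ
    exact ⟨_, .tensor hα hβ, Y, Z, rfl, h₁, h₂⟩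

end Realization

/-! ### Flatness and completeness for classical formulas. -/

/-- Truth of a classical formula under a single valuation. -/
def Formula.Holds (s : Valuation) : Formula → Prop
  | .var i => s i = true
  | .negVar i => s i = false
  | .bot => False
  -- Junk value: truth at a valuation is only used for classical formulas.
  | .dep _ _ => True
  | .and φ ψ => φ.Holds s ∧ ψ.Holds s
  | .tensor φ ψ => φ.Holds s ∨ ψ.Holds s

/-- Classical formulas are flat. -/
theorem sat_iff_forall_holds {α : Formula} (hc : α.IsClassical) (X : Team) :
    Sat X α ↔ ∀ s ∈ X, α.Holds s := by
  induction α generalizing X with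
  | var | negVar => rfl
  | bot => exact Set.eq_empty_iff_forall_notMem
  | dep => exact hc.elim
  | and φ ψ ih₁ ih₂ =>
    simp only [Sat, Formula.Holds, ih₁ hc.1, ih₂ hc.2]
    grind
  | tensor φ ψ ih₁ ih₂ =>
    simp only [Sat, Formula.Holds, ih₁ hc.1, ih₂ hc.2]
    constructor
    · rintro ⟨Y, Z, rfl, hY, hZ⟩ s (hs | hs)
      · exact .inl (hY s hs)
      · exact .inr (hZ s hs)
    · intro h
      refine ⟨{s ∈ X | φ.Holds s}, {s ∈ X | ψ.Holds s}, ?_, fun s hs => hs.2, fun s hs => hs.2⟩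
      ext s
      have := h s
      simp only [Set.mem_union, Set.mem_ofPred_eq]
      tauto

/-- Strong completeness for classical conclusions with respect to single valuations. -/
theorem derives_of_forall_holds {Γ : Set Formula} {α : Formula} (hα : α.IsClassical)
    (h : ∀ s : Valuation, (∀ γ ∈ Γ, γ.IsClassical → γ.Holds s) → α.Holds s) : Derives Γ α := by
  classical
  by_contra hd
  obtain ⟨Δ, hΓ, hΔ, hmax⟩ := Derives.exists_maximal hd
  have mem : ∀ {β}, Derives Δ β → β ∈ Δ := fun {β} hβ => by
    by_contra hn
    exact hΔ (hβ.cut (hmax β hn))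
  -- Weak tensor elimination applies because the underivable formula `α` is classical; a maximal set
  -- avoiding an arbitrary formula need not be prime.
  have prime : ∀ {β γ}, Derives Δ (.tensor β γ) → β ∈ Δ ∨ γ ∈ Δ := fun {β γ} ht => by
    by_contra! hn
    exact hΔ (.tensorE hα ht (hmax _ hn.1) (hmax _ hn.2))
  have consistent : ¬ Derives Δ .bot := fun hb => hΔ hb.exFalso
  let s : Valuation := fun i => decide (Formula.var i ∈ Δ)
  have holds_of_mem : ∀ β : Formula, β.IsClassical → β ∈ Δ → β.Holds s := by
    intro β
    induction β with
    | var i => exact fun _ hi => decide_eq_true hi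
    | negVar i =>
      exact fun _ hi => decide_eq_false fun hv => consistent (.botI (.andI (.hyp hv) (.hyp hi)))
    | bot => exact fun _ hb => consistent (.hyp hb)
    | dep => exact fun hc => hc.elim
    | and φ ψ ih₁ ih₂ =>
      exact fun hc hm => ⟨ih₁ hc.1 (mem (.andEleft (.hyp hm))), ih₂ hc.2 (mem (.andEright (.hyp hm)))⟩
    | tensor φ ψ ih₁ ih₂ => exact fun hc hm => (prime (.hyp hm)).imp (ih₁ hc.1) (ih₂ hc.2)
  have derives_of_holds : ∀ β : Formula, β.IsClassical → β.Holds s → Derives Δ β := by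
    intro β
    induction β with
    | var i => exact fun _ hi => .hyp (of_decide_eq_true hi)
    | negVar i =>
      -- Primeness applied to excluded middle puts `p_i` or its negation in `Δ`.
      exact fun _ hi => .hyp ((prime (.em Δ i)).resolve_left (of_decide_eq_false hi))
    | bot => exact fun _ hb => hb.elim
    | dep => exact fun hc => hc.elim
    | and φ ψ ih₁ ih₂ => exact fun hc hs => .andI (ih₁ hc.1 hs.1) (ih₂ hc.2 hs.2)
    | tensor φ ψ ih₁ ih₂ =>
      exact fun hc hs => hs.elim (fun hs => .tensorIleft (ih₁ hc.1 hs))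
        fun hs => .tensorIright (ih₂ hc.2 hs)
  exact hΔ (derives_of_holds α hα (h s fun γ hγ hc => holds_of_mem γ hc (hΓ hγ)))

end PDLogic

/-! ### Strong completeness. -/

theorem theorem4p19 (Γ : Set PDLogic.Formula) (φ : PDLogic.Formula)
    (h : PDLogic.Entails Γ φ) : PDLogic.Derives Γ φ := by
  open PDLogic in
  by_contra hd
  obtain ⟨Δ, hΓ, hΔ, hmax⟩ := Derives.exists_maximal hd
  let X : Team := {s | ∀ γ ∈ Δ, γ.IsClassical → γ.Holds s}
  have hX : Sat X φ := by
    refine h X fun γ hγ => ?_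
    -- If every realization of `γ` were missing from `Δ`, each would derive `φ` over `Δ` by
    -- maximality, and then so would `γ` itself.
    obtain ⟨α, hα, hmem⟩ : ∃ α, Realization γ α ∧ α ∈ Δ := by
      by_contra! hn
      exact hΔ (Realization.elim .hole (.hyp (hΓ hγ)) fun α hα => hmax α (hn α hα))
    exact hα.sat ((sat_iff_forall_holds hα.isClassical X).2 fun s hs => hs α hmem hα.isClassical)
  obtain ⟨α, hα, hXα⟩ := Realization.exists_sat hX
  exact hΔ (hα.derives (derives_of_forall_holds hα.isClassical
    ((sat_iff_forall_holds hα.isClassical X).1 hXα)))
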